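/- All functions are Lebesgue measurable on $\mathbb R$. The convolution of $f,g:\mathbb R\to[0,\infty]$ is $(f*g)(x)=\int_{\mathbb R} f(x-y)g(y)\,\mathrm dy$. A function $f:\mathbb R\to[0,\infty]$ is called symmetrically decreasing if $f(-x)=f(x)$ for all $x\in\mathbb R$ and $f(y)\le f(x)$ whenever $0<x<y$. The symmetric decreasing rearrangement $h^*$ of $h:\mathbb R\to[0,\infty]$ is the symmetrically decreasing function (unique up to equality a.e.) that is equimeasurable with $h$, i.e. $|\{h^*>\lambda\}|=|\{h>\lambda\}|$ for all $\lambda\ge 0$; explicitly, $h^*(x)=\sup\{\lambda : |\{h>\lambda\}|>2|x|\}$. Let $M_1=\mathbf 1_{(-1/2,1/2)}$ and $M_n=M_{n-1}*M_1$ for $n\ge 2$ (the centered cardinal B-spline of order $n$). **Theorem.** Let $n\ge 1$ and let $g_1,\dots,g_n$ be functions on $\mathbb R$ with $0\le g_j\le 1$ and $\int_{\mathbb R} g_j(x)\,\mathrm dx=1$ for all $1\le j\le n$. Then, for every function $h:\mathbb R\to[0,\infty]$, $$\int_{\mathbb R} h(x)\,(g_1*\cdots*g_n)(x)\,\mathrm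 dx\;\le\;\int_{\mathbb R} h^*(x)\,M_n(x)\,\mathrm dx .$$ If equality holds here for all symmetrically decreasing functions $h:\mathbb R\to[0,\infty]$, then $g_1^*=\cdots=g_n^*=M_1$ almost everywhere. -/

import Mathlib

open MeasureTheory Set
open scoped ENNReal

/-- A function `f : ℝ → [0,∞]` is symmetrically decreasing (s.d.) if it is even and
`f y ≤ f x` whenever `0 < x < y`. -/
def SymmDecreasing (f : ℝ → ℝ≥0∞) : Prop :=
  (∀ x, f (-x) = f x) ∧ ∀ x y, 0 < x → x < y → f y ≤ f x

/-- The symmetric decreasing rearrangement `f*` of `f : ℝ → [0,∞]`, that is, the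
(lower semicontinuous) symmetrically decreasing function that is equimeasurable with `f`:
`f*(x) = sup {t : 2 |x| < |{y : t < f y}|}`. -/
noncomputable def symmDecRearr (f : ℝ → ℝ≥0∞) (x : ℝ) : ℝ≥0∞ :=
  sSup {t : ℝ≥0∞ | ENNReal.ofReal (2 * |x|) < volume {y | t < f y}}

theorem symmDecRearr_symmDecreasing (f : ℝ → ℝ≥0∞) : SymmDecreasing (symmDecRearr f) := by
  refine ⟨fun x => by simp [symmDecRearr], fun x y hx hxy => ?_⟩
  refine sSup_le_sSup fun t ht => lt_of_le_of_lt (ENNReal.ofReal_le_ofReal ?_) ht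
  rw [abs_of_pos hx, abs_of_pos (hx.trans hxy)]
  linarith

/-- `f*` and `f` are equimeasurable. -/
theorem volume_lt_symmDecRearr (f : ℝ → ℝ≥0∞) (t : ℝ≥0∞) :
    volume {x | t < symmDecRearr f x} = volume {x | t < f x} := by
  have key : {x | t < symmDecRearr f x} =
      {x | ENNReal.ofReal (2 * |x|) < volume {y | t < f y}} := by
    ext x
    simp only [mem_ofPred_eq, symmDecRearr, lt_sSup_iff]
    constructor
    · rintro ⟨s, hs, hts⟩
      exact lt_of_lt_of_le hs (measure_mono fun y hy => hts.trans hy)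
    · intro h
      by_contra! hcon
      rcases eq_or_ne t ⊤ with rfl | ht
      · simp at h
      obtain ⟨u, hu, hut, hlim⟩ := exists_seq_strictAnti_tendsto' (lt_top_iff_ne_top.2 ht)
      have hU : {y | t < f y} = ⋃ n, {y | u n < f y} := by
        ext y
        simp only [mem_ofPred_eq, mem_iUnion]
        constructor
        · intro hy
          exact (hlim.eventually_lt_const hy).exists
        · rintro ⟨n, hn⟩
          exact (hut n).1.trans hn
      have hm : Monotone fun n => {y | u n < f y} :=
        fun m n hmn y hy => lt_of_le_of_lt (hu.antitone hmn) hy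
      rw [hU, hm.measure_iUnion, lt_iSup_iff] at h
      obtain ⟨n, hn⟩ := h
      exact absurd (hut n).1 (not_lt.2 (hcon (u n) hn))
  rw [key]
  generalize volume {y | t < f y} = m
  induction m with
  | top =>
    have : {x : ℝ | ENNReal.ofReal (2 * |x|) < (⊤ : ℝ≥0∞)} = univ :=
      eq_univ_of_forall fun x => ENNReal.ofReal_lt_top
    rw [this, Real.volume_univ]
  | coe r =>
    have : {x : ℝ | ENNReal.ofReal (2 * |x|) < (r : ℝ≥0∞)} =
        Ioo (-((r : ℝ) / 2)) ((r : ℝ) / 2) := by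
      ext x
      rw [mem_ofPred_eq, mem_Ioo, ← abs_lt, ← ENNReal.ofReal_coe_nnreal]
      rcases eq_or_lt_of_le r.2 with h0 | h0
      · have h0' : (r : ℝ) = 0 := h0.symm
        simp [h0']
      · exact (ENNReal.ofReal_lt_ofReal_iff h0).trans (by rw [lt_div_iff₀ two_pos, mul_comm]; rfl)
    rw [this, Real.volume_Ioo, ← ENNReal.ofReal_coe_nnreal]
    congr 1
    ring

/-- The convolution `g₁ * ⋯ * gₙ` with respect to Lebesgue measure, for `n ≥ 1`
(with the placeholder value `0` for `n = 0`). -/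
noncomputable def multiConv : (n : ℕ) → (Fin n → ℝ → ℝ≥0∞) → ℝ → ℝ≥0∞
  | 0, _ => 0
  | 1, g => g 0
  | n + 2, g => lconvolution (multiConv (n + 1) fun i => g i.castSucc) (g (Fin.last (n + 1))) volume

/-- The centered cardinal B-spline `Mₙ` of order `n ≥ 1`: `M₁` is the indicator function of
`(-1/2, 1/2)` and `Mₙ = Mₙ₋₁ * M₁` for `n ≥ 2` (with the placeholder value `0` for `n = 0`). -/
noncomputable def cardinalBSpline : ℕ → ℝ → ℝ≥0∞
  | 0 => 0
  | 1 => (Ioo (-1 / 2 : ℝ) (1 / 2)).indicator 1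
  | n + 2 => lconvolution (cardinalBSpline (n + 1)) (cardinalBSpline 1) volume

/-! Call `f` dominated by an even decreasing `F` if the integral of `f` over any measurable set `A`
is at most the integral of `F` over the centered interval of measure `|A|`. The inequality follows
from domination of `g₁ * ⋯ * gₙ` by `Mₙ`, by cutting `h` into superlevel sets.

Domination is proved by induction on the number of factors (`setLIntegral_lconvolution_le`). Slicing
the old convolution `f` into superlevel sets `B` leaves double integrals of `g (x - y)` over `A ×
B`. The two-set Riesz inequality `lintegral_lintegral_neg_add_le_centeredInterval` replaces `A`, `B`
by centered intervals and `g` by `M₁`. What remains is `f*` integrated against an even decreasing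
kernel; slicing the kernel into centered intervals lets `F` replace `f*`.

For equality, testing with indicators of centered intervals gives `g₁ * ⋯ * gₙ` and `Mₙ` the same
second moment, so the variances of the `gⱼ` add up to at most `n / 12`. A density bounded by one has
variance at least `1 / 12`, attained only by the indicator of a unit interval
(`one_div_twelve_le_variance`), so every `gⱼ` is such an indicator a.e. -/

/-! ### Centered intervals and even decreasing functions -/

/-- The open interval centered at `0` of length `m ∈ [0,∞]`. -/
def centeredInterval (m : ℝ≥0∞) : Set ℝ := {x | ENNReal.ofReal (2 * |x|) < m}

theorem mem_centeredInterval {m : ℝ≥0∞} {x : ℝ} :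
    x ∈ centeredInterval m ↔ ENNReal.ofReal (2 * |x|) < m := Iff.rfl

theorem centeredInterval_top : centeredInterval ⊤ = univ :=
  eq_univ_of_forall fun _ => ENNReal.ofReal_lt_top

theorem mem_centeredInterval_ofReal {r x : ℝ} :
    x ∈ centeredInterval (ENNReal.ofReal r) ↔ 2 * |x| < r := by
  rw [mem_centeredInterval]
  constructor
  · intro h
    exact (ENNReal.ofReal_lt_ofReal_iff'.1 h).1
  · intro h
    exact (ENNReal.ofReal_lt_ofReal_iff (lt_of_le_of_lt (by positivity) h)).2 h

theorem centeredInterval_ofReal (r : ℝ) :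
    centeredInterval (ENNReal.ofReal r) = Ioo (-(r / 2)) (r / 2) := by
  ext x
  rw [mem_centeredInterval_ofReal, mem_Ioo, ← abs_lt, lt_div_iff₀ two_pos, mul_comm]

theorem volume_centeredInterval (m : ℝ≥0∞) : volume (centeredInterval m) = m := by
  induction m with
  | top => rw [centeredInterval_top, Real.volume_univ]
  | coe r =>
    rw [← ENNReal.ofReal_coe_nnreal, centeredInterval_ofReal, Real.volume_Ioo]
    congr 1
    ring

theorem measurableSet_centeredInterval (m : ℝ≥0∞) : MeasurableSet (centeredInterval m) :=
  measurableSet_lt (by fun_prop) measurable_const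

theorem centeredInterval_inter (m k : ℝ≥0∞) :
    centeredInterval m ∩ centeredInterval k = centeredInterval (min m k) := by
  ext x
  simp [mem_centeredInterval]

theorem centeredInterval_one : centeredInterval 1 = Ioo (-1 / 2 : ℝ) (1 / 2) := by
  rw [← ENNReal.ofReal_one, centeredInterval_ofReal, neg_div]

/-- `f` is a decreasing function of `|x|`. -/
def AbsAntitone (f : ℝ → ℝ≥0∞) : Prop := ∀ x y, |x| ≤ |y| → f y ≤ f x

theorem AbsAntitone.apply_neg {f : ℝ → ℝ≥0∞} (hf : AbsAntitone f) (x : ℝ) : f (-x) = f x :=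
  le_antisymm (hf _ _ (abs_neg x).ge) (hf _ _ (abs_neg x).le)

/-- The converse fails: `SymmDecreasing` leaves the value at `0` free, while `AbsAntitone` makes it
the maximum. -/
theorem AbsAntitone.symmDecreasing {f : ℝ → ℝ≥0∞} (hf : AbsAntitone f) : SymmDecreasing f :=
  ⟨hf.apply_neg, fun x y hx hxy => hf x y (by
    rw [abs_of_pos hx, abs_of_pos (hx.trans hxy)]; exact hxy.le)⟩

theorem absAntitone_indicator_centeredInterval (m : ℝ≥0∞) :
    AbsAntitone ((centeredInterval m).indicator 1) := by
  classical
  intro x y hxy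
  simp only [indicator_apply, Pi.one_apply]
  split_ifs with hy hx
  · exact le_rfl
  · exact absurd (lt_of_le_of_lt (ENNReal.ofReal_le_ofReal (by linarith)) hy) hx
  · exact zero_le_one
  · exact le_rfl

/-- A point `x` missing from `S` forces `S ⊆ [-|x|, |x|]`, hence `|S| ≤ 2|x|`. -/
theorem centeredInterval_subset_of_abs_le {S : Set ℝ}
    (hS : ∀ x y, |x| ≤ |y| → y ∈ S → x ∈ S) : centeredInterval (volume S) ⊆ S := by
  intro x hx
  by_contra hxS
  have hsub : S ⊆ Icc (-|x|) |x| := fun y hy => by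
    rw [mem_Icc, ← abs_le]
    by_contra! hlt
    exact hxS (hS x y hlt.le hy)
  have := measure_mono (μ := volume) hsub
  rw [Real.volume_Icc] at this
  refine absurd hx (not_lt.2 (this.trans_eq ?_))
  congr 1
  ring

theorem OrdConnected.of_abs_le {S : Set ℝ} (hS : ∀ x y, |x| ≤ |y| → y ∈ S → x ∈ S) :
    S.OrdConnected := by
  refine ⟨fun x hx y hy z hz => ?_⟩
  rcases le_total |x| |y| with h | h
  · exact hS z y (by have := abs_le_max_abs_abs hz.1 hz.2; rwa [max_eq_right h] at this) hy
  · exact hS z x (by have := abs_le_max_abs_abs hz.1 hz.2; rwa [max_eq_left h] at this) hx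

theorem ae_eq_centeredInterval_of_abs_le {S : Set ℝ}
    (hS : ∀ x y, |x| ≤ |y| → y ∈ S → x ∈ S) : S =ᵐ[volume] centeredInterval (volume S) := by
  have hsub := centeredInterval_subset_of_abs_le hS
  by_cases hfin : volume S = ⊤
  · rw [hfin, centeredInterval_top] at hsub ⊢
    exact (univ_subset_iff.1 hsub).eventuallyEq
  · exact (ae_eq_of_subset_of_measure_ge hsub (volume_centeredInterval _).ge
      (measurableSet_centeredInterval _).nullMeasurableSet hfin).symm

theorem AbsAntitone.ae_eq_centeredInterval {f : ℝ → ℝ≥0∞} (hf : AbsAntitone f) (t : ℝ≥0∞) :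
    {x | t < f x} =ᵐ[volume] centeredInterval (volume {x | t < f x}) :=
  ae_eq_centeredInterval_of_abs_le fun x y hxy hy => lt_of_lt_of_le hy (hf x y hxy)

theorem AbsAntitone.measurable {f : ℝ → ℝ≥0∞} (hf : AbsAntitone f) : Measurable f :=
  measurable_of_Ioi fun t => (OrdConnected.of_abs_le (S := {x | t < f x})
    fun x y hxy hy => lt_of_lt_of_le hy (hf x y hxy)).measurableSet

theorem absAntitone_symmDecRearr (f : ℝ → ℝ≥0∞) : AbsAntitone (symmDecRearr f) := fun x y hxy =>
  sSup_le_sSup fun _ ht => lt_of_le_of_lt (ENNReal.ofReal_le_ofReal (by linarith)) ht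

theorem setOf_lt_symmDecRearr_ae_eq (f : ℝ → ℝ≥0∞) (t : ℝ≥0∞) :
    {x | t < symmDecRearr f x} =ᵐ[volume] centeredInterval (volume {x | t < f x}) := by
  rw [← volume_lt_symmDecRearr]
  exact (absAntitone_symmDecRearr f).ae_eq_centeredInterval t

theorem symmDecRearr_congr_ae {f g : ℝ → ℝ≥0∞} (h : f =ᵐ[volume] g) :
    symmDecRearr f = symmDecRearr g := by
  ext x
  have : ∀ t, volume {y | t < f y} = volume {y | t < g y} := fun t =>
    measure_congr (by filter_upwards [h] with y hy; exact congrArg (t < ·) hy)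
  simp only [symmDecRearr, this]

/-! ### Layer cake formulas -/

theorem lintegral_Ioi_indicator_ofReal_lt (c : ℝ≥0∞) :
    ∫⁻ s in Ioi (0 : ℝ), (Iio c).indicator 1 (ENNReal.ofReal s) = c := by
  have hm : MeasurableSet {s : ℝ | ENNReal.ofReal s < c} :=
    measurableSet_lt (by fun_prop) measurable_const
  have h1 : ∀ s : ℝ, (Iio c).indicator (1 : ℝ≥0∞ → ℝ≥0∞) (ENNReal.ofReal s) =
      {s : ℝ | ENNReal.ofReal s < c}.indicator 1 s := fun s => by
    simp [indicator_apply]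
  simp only [h1]
  rw [lintegral_indicator_one hm, Measure.restrict_apply hm]
  induction c with
  | top => simp
  | coe r =>
    have : {s : ℝ | ENNReal.ofReal s < (r : ℝ≥0∞)} ∩ Ioi 0 = Ioo 0 (r : ℝ) := by
      ext s
      simp only [mem_inter_iff, mem_ofPred_eq, mem_Ioi, mem_Ioo]
      constructor
      · rintro ⟨h, h0⟩
        exact ⟨h0, (ENNReal.ofReal_lt_iff_lt_toReal h0.le ENNReal.coe_ne_top).1 h⟩
      · rintro ⟨h0, h⟩
        exact ⟨(ENNReal.ofReal_lt_iff_lt_toReal h0.le ENNReal.coe_ne_top).2 h, h0⟩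
    rw [this, Real.volume_Ioo, sub_zero, ENNReal.ofReal_coe_nnreal]

/-- Layer cake representation with a weight. -/
theorem lintegral_mul_eq_lintegral_setLIntegral {f k : ℝ → ℝ≥0∞} (hf : Measurable f)
    (hk : Measurable k) :
    ∫⁻ x, f x * k x = ∫⁻ s in Ioi (0 : ℝ), ∫⁻ x in {x | ENNReal.ofReal s < f x}, k x := by
  have hF : Measurable fun p : ℝ × ℝ => (Iio (f p.1)).indicator 1 (ENNReal.ofReal p.2) * k p.1 := by
    refine Measurable.mul ?_ (by fun_prop)
    have hS : MeasurableSet {p : ℝ × ℝ | ENNReal.ofReal p.2 < f p.1} :=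
      measurableSet_lt (by fun_prop) (by fun_prop)
    convert (measurable_one (α := ℝ≥0∞) (β := ℝ × ℝ)).indicator hS using 2 with p
    classical simp [indicator_apply]
  calc ∫⁻ x, f x * k x
      = ∫⁻ x, ∫⁻ s in Ioi (0 : ℝ), (Iio (f x)).indicator 1 (ENNReal.ofReal s) * k x := by
        refine lintegral_congr fun x => ?_
        rw [lintegral_mul_const _ (by
          refine (measurable_one.indicator measurableSet_Iio).comp ENNReal.measurable_ofReal),
          lintegral_Ioi_indicator_ofReal_lt]
    _ = ∫⁻ s in Ioi (0 : ℝ), ∫⁻ x, (Iio (f x)).indicator 1 (ENNReal.ofReal s) * k x :=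
        lintegral_lintegral_swap hF.aemeasurable
    _ = _ := by
        refine lintegral_congr fun s => ?_
        rw [← lintegral_indicator (measurableSet_lt measurable_const hf)]
        refine lintegral_congr fun x => ?_
        simp only [indicator_apply, mem_Iio, mem_ofPred_eq, Pi.one_apply]
        split_ifs <;> simp

theorem lintegral_eq_lintegral_volume_lt {f : ℝ → ℝ≥0∞} (hf : Measurable f) :
    ∫⁻ x, f x = ∫⁻ s in Ioi (0 : ℝ), volume {x | ENNReal.ofReal s < f x} := by
  simpa using lintegral_mul_eq_lintegral_setLIntegral hf (measurable_const (a := (1 : ℝ≥0∞)))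

/-- Excess integrals over a level only depend on the distribution function. -/
theorem lintegral_symmDecRearr_tsub {f : ℝ → ℝ≥0∞} (hf : Measurable f) (t : ℝ≥0∞) :
    ∫⁻ x, (symmDecRearr f x - t) = ∫⁻ x, (f x - t) := by
  rw [lintegral_eq_lintegral_volume_lt ((absAntitone_symmDecRearr f).measurable.sub_const t),
    lintegral_eq_lintegral_volume_lt (hf.sub_const t)]
  refine lintegral_congr fun s => ?_
  simp only [lt_tsub_iff_left]
  exact volume_lt_symmDecRearr f _

theorem lintegral_symmDecRearr {f : ℝ → ℝ≥0∞} (hf : Measurable f) :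
    ∫⁻ x, symmDecRearr f x = ∫⁻ x, f x := by
  simpa using lintegral_symmDecRearr_tsub hf 0

/-! ### Convolution of even decreasing functions -/

theorem ENNReal.mul_add_mul_le_mul_add_mul_of_le {a b c d : ℝ≥0∞} (hab : a ≤ b) (hcd : c ≤ d) :
    a * d + b * c ≤ a * c + b * d := by
  obtain ⟨e, rfl⟩ := exists_add_of_le hab
  obtain ⟨f, rfl⟩ := exists_add_of_le hcd
  have : a * (c + f) + (a + e) * c + e * f = a * c + (a + e) * (c + f) := by ring
  rw [← this]
  exact le_self_add

/-- Folding an integral over the line about the point `m`. -/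
theorem lintegral_eq_setLIntegral_Ioi_add_reflection {F : ℝ → ℝ≥0∞} (hF : Measurable F) (m : ℝ) :
    ∫⁻ z, F z = ∫⁻ z in Ioi m, (F z + F (2 * m - z)) := by
  have h1 : ∫⁻ z in Ioi m, F (2 * m - z) = ∫⁻ z in Iio m, F z := by
    rw [← lintegral_indicator measurableSet_Ioi, ← lintegral_indicator measurableSet_Iio,
      ← lintegral_sub_left_eq_self (μ := volume) ((Iio m).indicator F) (2 * m)]
    refine lintegral_congr fun z => ?_
    simp only [indicator_apply, mem_Ioi, mem_Iio]
    have : m < z ↔ 2 * m - z < m := by constructor <;> intro h <;> linarith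
    simp [this]
  rw [lintegral_add_left hF, h1, add_comm,
    setLIntegral_congr Iio_ae_eq_Iic, ← compl_Iic, lintegral_add_compl _ measurableSet_Iic]

/-- For `0 ≤ x ≤ y`, fold both integrals about the midpoint of `x` and `y`. Reflection swaps the two
values of `G` up to parity, so each pair of points reduces to the two-term rearrangement inequality.
-/
theorem AbsAntitone.lconvolution {F G : ℝ → ℝ≥0∞} (hF : AbsAntitone F) (hG : AbsAntitone G) :
    AbsAntitone (lconvolution F G volume) := by
  have hFm := hF.measurable
  have hGm := hG.measurable
  have hneg : ∀ x, MeasureTheory.lconvolution F G volume (-x) =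
      MeasureTheory.lconvolution F G volume x := fun x => by
    simp only [lconvolution_def]
    rw [← lintegral_neg_eq_self]
    refine lintegral_congr fun y => ?_
    rw [hF.apply_neg, ← hG.apply_neg]
    congr 2
    ring
  have habs : ∀ x, MeasureTheory.lconvolution F G volume |x| =
      MeasureTheory.lconvolution F G volume x := fun x => by
    rcases abs_choice x with h | h <;> rw [h]
    exact hneg x
  intro x y hxy
  rw [← habs x, ← habs y]
  have hx0 := abs_nonneg x
  generalize |x| = x at hxy hx0
  generalize |y| = y at hxy
  simp only [lconvolution_def]
  rw [lintegral_eq_setLIntegral_Ioi_add_reflection (by fun_prop) ((x + y) / 2),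
    lintegral_eq_setLIntegral_Ioi_add_reflection (F := fun z => F z * G (-z + x)) (by fun_prop)
      ((x + y) / 2)]
  refine setLIntegral_mono (by fun_prop) fun z hz => ?_
  rw [mem_Ioi] at hz
  have e1 : G (-(2 * ((x + y) / 2) - z) + y) = G (-z + x) := by
    rw [← hG.apply_neg]; congr 1; ring
  have e2 : G (-(2 * ((x + y) / 2) - z) + x) = G (-z + y) := by
    rw [← hG.apply_neg]; congr 1; ring
  rw [e1, e2]
  refine ENNReal.mul_add_mul_le_mul_add_mul_of_le (hF _ _ ?_) (hG _ _ ?_)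
  · rw [abs_of_pos (a := z) (by linarith), abs_le]
    constructor <;> linarith
  · rw [abs_of_nonpos (a := -z + x) (by linarith), abs_le]
    constructor <;> linarith

/-! ### The Riesz inequality for two sets -/

/-- Substituting `x = y + z` turns the double integral into `g` weighted by the overlap of `B` with
`A - z`. -/
theorem lintegral_lintegral_neg_add_eq {A B : Set ℝ} (hA : MeasurableSet A) {g : ℝ → ℝ≥0∞}
    (hg : Measurable g) :
    ∫⁻ x in A, ∫⁻ y in B, g (-y + x) = ∫⁻ z, g z * volume (B ∩ (· + z) ⁻¹' A) := by
  have hm : Measurable fun p : ℝ × ℝ => A.indicator (1 : ℝ → ℝ≥0∞) (p.1 + p.2) * g p.2 :=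
    ((measurable_one.indicator hA).comp (by fun_prop)).mul (by fun_prop)
  calc ∫⁻ x in A, ∫⁻ y in B, g (-y + x)
      = ∫⁻ y in B, ∫⁻ x in A, g (-y + x) :=
        lintegral_lintegral_swap (by fun_prop)
    _ = ∫⁻ y in B, ∫⁻ z, A.indicator (1 : ℝ → ℝ≥0∞) (y + z) * g z := by
        refine lintegral_congr fun y => ?_
        rw [← lintegral_indicator hA, ← lintegral_add_left_eq_self _ y]
        refine lintegral_congr fun z => ?_
        by_cases h : y + z ∈ A <;> simp [h]
    _ = ∫⁻ z, ∫⁻ y in B, A.indicator (1 : ℝ → ℝ≥0∞) (y + z) * g z :=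
        lintegral_lintegral_swap hm.aemeasurable
    _ = _ := by
        refine lintegral_congr fun z => ?_
        have hs : MeasurableSet ((· + z) ⁻¹' A) := measurable_add_const z hA
        have h1 : Measurable fun y => A.indicator (1 : ℝ → ℝ≥0∞) (y + z) :=
          (measurable_one.indicator hA).comp (measurable_add_const z)
        rw [lintegral_mul_const _ h1, mul_comm,
          inter_comm, ← Measure.restrict_apply hs, ← lintegral_indicator_one hs]
        rfl

theorem lintegral_volume_inter_preimage_add {A B : Set ℝ} (hA : MeasurableSet A) :
    ∫⁻ z, volume (B ∩ (· + z) ⁻¹' A) = volume A * volume B := by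
  have := lintegral_lintegral_neg_add_eq (B := B) hA (measurable_const (a := (1 : ℝ≥0∞)))
  simpa [mul_comm] using this.symm

/-- The mass of `A` below `c` is 1-Lipschitz in `c` and runs from `0` to `|A|`; the strict bounds on
`t` let the limits at infinity feed the intermediate value theorem. -/
theorem exists_volume_inter_Iic_eq {A : Set ℝ} (hfin : volume A ≠ ⊤)
    {t : ℝ≥0∞} (ht0 : 0 < t) (ht : t < volume A) : ∃ c, volume (A ∩ Iic c) = t := by
  have : IsFiniteMeasure (volume.restrict A) := ⟨by simpa using hfin.lt_top⟩
  set F : ℝ → ℝ := fun c => (volume.restrict A).real (Iic c) with hF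
  have hlip : LipschitzWith 1 F := by
    refine LipschitzWith.of_le_add fun x y => ?_
    have h1 : volume.restrict A (Iic x) ≤ volume.restrict A (Iic y) + volume (Ioc y x) := by
      refine (measure_mono (t := Iic y ∪ Ioc y x) fun z hz => ?_).trans
        ((measure_union_le _ _).trans (add_le_add le_rfl (Measure.restrict_apply_le _ _)))
      rcases le_or_gt z y with h | h
      exacts [Or.inl h, Or.inr ⟨h, hz⟩]
    rw [Real.volume_Ioc] at h1
    have h2 := ENNReal.toReal_mono (by finiteness) h1
    rw [ENNReal.toReal_add (by finiteness) (by finiteness), ENNReal.toReal_ofReal'] at h2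
    refine h2.trans (add_le_add le_rfl ?_)
    rw [Real.dist_eq]
    exact max_le (le_abs_self _) (abs_nonneg _)
  have htop : t ≠ ⊤ := (ht.trans_le le_top).ne
  have hbot : Filter.Tendsto F Filter.atBot (nhds 0) := by
    have h := tendsto_measure_iInter_atBot (μ := volume.restrict A) (s := fun c : ℝ => Iic c)
      (fun _ => measurableSet_Iic.nullMeasurableSet) (fun _ _ h => Iic_subset_Iic.2 h)
      ⟨0, by finiteness⟩
    rw [iInter_Iic_eq_empty_iff.2 (by simp), measure_empty] at h
    exact (ENNReal.tendsto_toReal ENNReal.zero_ne_top).comp h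
  have hatop : Filter.Tendsto F Filter.atTop (nhds (volume A).toReal) := by
    have h := tendsto_measure_Iic_atTop (volume.restrict A)
    rw [Measure.restrict_apply_univ] at h
    exact (ENNReal.tendsto_toReal hfin).comp h
  have h0 : (0 : ℝ) < t.toReal := ENNReal.toReal_pos ht0.ne' htop
  have h1 : t.toReal < (volume A).toReal := (ENNReal.toReal_lt_toReal htop hfin).2 ht
  obtain ⟨c, hc⟩ := mem_range_of_exists_le_of_exists_ge hlip.continuous
    ((hbot.eventually_lt_const h0).exists.imp fun _ => le_of_lt)
    ((hatop.eventually_const_lt h1).exists.imp fun _ => le_of_lt)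
  refine ⟨c, ?_⟩
  rw [inter_comm, ← Measure.restrict_apply measurableSet_Iic]
  exact (ENNReal.toReal_eq_toReal_iff' (by finiteness) htop).1 hc

/-- Cutting off the lowest mass `t` from `A` and `B` bounds the correlation of `A` and `B`. -/
theorem lintegral_lintegral_neg_add_le {A B : Set ℝ} (hA : MeasurableSet A)
    (hAfin : volume A ≠ ⊤) (hBfin : volume B ≠ ⊤) {g : ℝ → ℝ≥0∞} (hg : Measurable g)
    (hg1 : ∀ x, g x ≤ 1) (hgint : ∫⁻ x, g x = 1) {t : ℝ≥0∞} (ht0 : 0 < t) (htA : t < volume A)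
    (htB : t < volume B) :
    ∫⁻ x in A, ∫⁻ y in B, g (-y + x) ≤ t + (volume A - t) * (volume B - t) := by
  obtain ⟨c, hc⟩ := exists_volume_inter_Iic_eq hAfin ht0 htA
  obtain ⟨d, hd⟩ := exists_volume_inter_Iic_eq hBfin ht0 htB
  have htop : t ≠ ⊤ := (htA.trans_le le_top).ne
  have hsub : ∀ {S : Set ℝ} {e : ℝ}, volume (S ∩ Iic e) = t → volume (S ∩ Ioi e) = volume S - t := by
    intro S e he
    rw [← measure_inter_add_sdiff S (measurableSet_Iic (a := e)), he, sdiff_eq, compl_Iic,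
      ENNReal.add_sub_cancel_left htop]
  -- Compare the cut `d` of `B` with the shifted cut `c - z` of `A`. Beyond the larger of the two a
  -- point lies in both trimmed sets, so only one piece of mass `t` is lost.
  have key : ∀ z, volume (B ∩ (· + z) ⁻¹' A) ≤
      t + volume ((B ∩ Ioi d) ∩ (· + z) ⁻¹' (A ∩ Ioi c)) := by
    intro z
    rcases le_total (c - z) d with h | h
    · rw [← hd]
      refine (measure_mono fun y hy => ?_).trans (measure_union_le _ _)
      rcases le_or_gt y d with h' | h'
      · exact Or.inl ⟨hy.1, h'⟩
      · exact Or.inr ⟨⟨hy.1, h'⟩, hy.2, by simp only [mem_Ioi]; linarith⟩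
    · rw [← hc, ← measure_preimage_add_right volume z (A ∩ Iic c)]
      refine (measure_mono fun y hy => ?_).trans (measure_union_le _ _)
      rcases le_or_gt (y + z) c with h' | h'
      · exact Or.inl ⟨hy.2, h'⟩
      · exact Or.inr ⟨⟨hy.1, by simp only [mem_Ioi]; linarith⟩, hy.2, h'⟩
  rw [lintegral_lintegral_neg_add_eq hA hg]
  calc ∫⁻ z, g z * volume (B ∩ (· + z) ⁻¹' A)
      ≤ ∫⁻ z, (g z * t + volume ((B ∩ Ioi d) ∩ (· + z) ⁻¹' (A ∩ Ioi c))) := by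
        -- The constant term keeps the factor `g`, of total mass one; on the trimmed overlap `g` is
        -- bounded by one.
        refine lintegral_mono fun z => ?_
        calc _ ≤ g z * (t + volume ((B ∩ Ioi d) ∩ (· + z) ⁻¹' (A ∩ Ioi c))) := by
              gcongr; exact key z
          _ ≤ _ := by
              rw [mul_add]
              gcongr
              exact mul_le_of_le_one_left' (hg1 z)
    _ = _ := by
        rw [lintegral_add_left (by fun_prop), lintegral_mul_const _ hg, hgint, one_mul,
          lintegral_volume_inter_preimage_add (hA.inter measurableSet_Ioi), hsub hc, hsub hd]

/-- For this `t` the trimmed lengths `a - t` and `b - t` add up to one, so the trimmed intervals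
overlap only for shifts `|z| < 1/2`, where the weight is one. Thus the estimates in
`lintegral_lintegral_neg_add_le` lose nothing for intervals. -/
theorem le_lintegral_lintegral_centeredInterval {a b t : ℝ} (ht : 2 * t = a + b - 1) (ht0 : 0 < t)
    (hta : t < a) (htb : t < b) :
    ENNReal.ofReal t + ENNReal.ofReal (a - t) * ENNReal.ofReal (b - t) ≤
      ∫⁻ x in centeredInterval (ENNReal.ofReal a), ∫⁻ y in centeredInterval (ENNReal.ofReal b),
        (centeredInterval 1).indicator 1 (-y + x) := by
  have hm : Measurable ((centeredInterval 1).indicator (1 : ℝ → ℝ≥0∞)) :=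
    measurable_one.indicator (measurableSet_centeredInterval _)
  rw [lintegral_lintegral_neg_add_eq (measurableSet_centeredInterval _) hm]
  have key : ∀ z, (centeredInterval 1).indicator 1 z * ENNReal.ofReal t +
      volume (centeredInterval (ENNReal.ofReal (b - t)) ∩
        (· + z) ⁻¹' centeredInterval (ENNReal.ofReal (a - t))) ≤
      (centeredInterval 1).indicator 1 z * volume (centeredInterval (ENNReal.ofReal b) ∩
        (· + z) ⁻¹' centeredInterval (ENNReal.ofReal a)) := by
    intro z
    simp only [centeredInterval_ofReal, centeredInterval_one, preimage_add_const_Ioo, Ioo_inter_Ioo,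
      Real.volume_Ioo]
    by_cases hz : z ∈ Ioo (-1 / 2 : ℝ) (1 / 2)
    · have hz1 := hz.1
      have hz2 := hz.2
      simp only [hz, indicator_of_mem, Pi.one_apply, one_mul]
      rw [← ENNReal.ofReal_add ht0.le]
      · refine ENNReal.ofReal_le_ofReal ?_
        simp only [max_def, min_def]
        split_ifs <;> linarith
      · simp only [max_def, min_def]
        split_ifs <;> linarith
    · simp only [hz, not_false_eq_true, indicator_of_notMem, zero_mul, zero_add, nonpos_iff_eq_zero,
        ENNReal.ofReal_eq_zero]
      rw [mem_Ioo, not_and_or, not_lt, not_lt] at hz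
      simp only [max_def, min_def]
      rcases hz with hz | hz <;> split_ifs <;> linarith
  refine le_trans ?_ (lintegral_mono key)
  rw [lintegral_add_left (by fun_prop), lintegral_mul_const _ hm,
    lintegral_indicator_one (measurableSet_centeredInterval _), volume_centeredInterval, one_mul,
    lintegral_volume_inter_preimage_add (measurableSet_centeredInterval _), volume_centeredInterval, volume_centeredInterval]

theorem lintegral_lintegral_neg_add_le_volume {A B : Set ℝ} {g : ℝ → ℝ≥0∞}
    (hgint : ∫⁻ x, g x = 1) : ∫⁻ x in A, ∫⁻ y in B, g (-y + x) ≤ volume A := by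
  calc _ ≤ ∫⁻ _ in A, 1 := by
        refine lintegral_mono fun x => (setLIntegral_le_lintegral _ _).trans ?_
        rw [← hgint, ← lintegral_sub_left_eq_self g x]
        simp [neg_add_eq_sub]
    _ = _ := by simp

theorem lintegral_lintegral_neg_add_le_volume' {A B : Set ℝ} {g : ℝ → ℝ≥0∞} (hg : Measurable g)
    (hgint : ∫⁻ x, g x = 1) : ∫⁻ x in A, ∫⁻ y in B, g (-y + x) ≤ volume B := by
  rw [lintegral_lintegral_swap (by fun_prop)]
  calc _ ≤ ∫⁻ _ in B, 1 := by
        refine lintegral_mono fun y => (setLIntegral_le_lintegral _ _).trans ?_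
        rw [lintegral_add_left_eq_self, hgint]
    _ = _ := by simp

theorem neg_add_mem_centeredInterval_one {a b x y : ℝ} (h : a + b ≤ 1)
    (hx : 2 * |x| < a) (hy : 2 * |y| < b) : -y + x ∈ centeredInterval 1 := by
  rw [← ENNReal.ofReal_one, mem_centeredInterval_ofReal]
  have := abs_add_le (-y) x
  rw [abs_neg] at this
  linarith

/-- The convolution of the indicator functions of the unit interval and of a centered interval of
length at least `b + 1` equals one on the centered interval of length `b`. -/
theorem lintegral_lintegral_centeredInterval_of_add_one_le {a b : ℝ≥0∞} (h : b + 1 ≤ a) :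
    ∫⁻ y in centeredInterval b, ∫⁻ x in centeredInterval a,
      (centeredInterval 1).indicator (1 : ℝ → ℝ≥0∞) (-y + x) = b := by
  have hm : Measurable ((centeredInterval 1).indicator (1 : ℝ → ℝ≥0∞)) :=
    measurable_one.indicator (measurableSet_centeredInterval _)
  have : ∀ y ∈ centeredInterval b, ∫⁻ x in centeredInterval a,
      (centeredInterval 1).indicator (1 : ℝ → ℝ≥0∞) (-y + x) = 1 := fun y hy => by
    rw [← lintegral_indicator (measurableSet_centeredInterval _),
      ← lintegral_add_left_eq_self _ y]
    refine Eq.trans ?_ ((lintegral_indicator_one (measurableSet_centeredInterval 1)).trans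
      (volume_centeredInterval 1))
    refine lintegral_congr fun z => ?_
    by_cases hz : z ∈ centeredInterval 1
    · have hmem : y + z ∈ centeredInterval a := by
        rw [mem_centeredInterval] at hy hz ⊢
        refine lt_of_lt_of_le (lt_of_le_of_lt ?_ (ENNReal.add_lt_add hy hz)) h
        rw [← ENNReal.ofReal_add (by positivity) (by positivity)]
        refine ENNReal.ofReal_le_ofReal ?_
        have := abs_add_le y z
        linarith
      simp [hmem]
    · by_cases hmem : y + z ∈ centeredInterval a <;> simp [hmem, hz]
  rw [setLIntegral_congr_fun (measurableSet_centeredInterval _) this]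
  simp [volume_centeredInterval]

/-- The one-dimensional Riesz rearrangement inequality for two sets and a density bounded by one. -/
theorem lintegral_lintegral_neg_add_le_centeredInterval {A B : Set ℝ} (hA : MeasurableSet A)
    {g : ℝ → ℝ≥0∞} (hg : Measurable g) (hg1 : ∀ x, g x ≤ 1) (hgint : ∫⁻ x, g x = 1) :
    ∫⁻ x in A, ∫⁻ y in B, g (-y + x) ≤
      ∫⁻ x in centeredInterval (volume A), ∫⁻ y in centeredInterval (volume B),
        (centeredInterval 1).indicator 1 (-y + x) := by
  have hm : Measurable ((centeredInterval 1).indicator (1 : ℝ → ℝ≥0∞)) :=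
    measurable_one.indicator (measurableSet_centeredInterval _)
  -- If the measures differ by at least one, the trivial bound by the smaller is attained. This also
  -- disposes of infinite measures.
  by_cases h1 : volume B + 1 ≤ volume A
  · refine (lintegral_lintegral_neg_add_le_volume' hg hgint).trans ?_
    rw [lintegral_lintegral_swap (by fun_prop),
      lintegral_lintegral_centeredInterval_of_add_one_le h1]
  by_cases h2 : volume A + 1 ≤ volume B
  · refine (lintegral_lintegral_neg_add_le_volume hgint).trans ?_
    have e : ∀ x y : ℝ, (centeredInterval 1).indicator (1 : ℝ → ℝ≥0∞) (-y + x) =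
        (centeredInterval 1).indicator (1 : ℝ → ℝ≥0∞) (-x + y) := fun x y => by
      rw [← (absAntitone_indicator_centeredInterval 1).apply_neg]
      congr 1; ring
    simp_rw [e]
    rw [lintegral_lintegral_centeredInterval_of_add_one_le h2]
  rw [not_le] at h1 h2
  have hAfin : volume A ≠ ⊤ := h1.ne_top
  have hBfin : volume B ≠ ⊤ := h2.ne_top
  set a := (volume A).toReal with ha
  set b := (volume B).toReal with hb
  have ha' : volume A = ENNReal.ofReal a := (ENNReal.ofReal_toReal hAfin).symm
  have hb' : volume B = ENNReal.ofReal b := (ENNReal.ofReal_toReal hBfin).symm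
  have ha0 : 0 ≤ a := ENNReal.toReal_nonneg
  have hb0 : 0 ≤ b := ENNReal.toReal_nonneg
  have hab : a < b + 1 := by
    rw [ha', hb', ← ENNReal.ofReal_one, ← ENNReal.ofReal_add hb0 zero_le_one] at h1
    exact (ENNReal.ofReal_lt_ofReal_iff (by linarith)).1 h1
  have hba : b < a + 1 := by
    rw [ha', hb', ← ENNReal.ofReal_one, ← ENNReal.ofReal_add ha0 zero_le_one] at h2
    exact (ENNReal.ofReal_lt_ofReal_iff (by linarith)).1 h2
  rcases le_or_gt (a + b) 1 with hle | hlt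
  -- All differences of points of the two intervals lie in the unit interval, so the bound `g ≤ 1`
  -- is attained.
  · calc _ ≤ ∫⁻ _ in A, ∫⁻ _ in B, 1 := by gcongr; exact hg1 _
      _ = ∫⁻ _ in centeredInterval (volume A), ∫⁻ _ in centeredInterval (volume B), 1 := by
          simp [volume_centeredInterval]
      _ = _ := by
          refine setLIntegral_congr_fun (measurableSet_centeredInterval _) fun x hx =>
            setLIntegral_congr_fun (measurableSet_centeredInterval _) fun y hy => ?_
          rw [ha', mem_centeredInterval_ofReal] at hx
          rw [hb', mem_centeredInterval_ofReal] at hy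
          simp [neg_add_mem_centeredInterval_one hle hx hy]
  -- The conditions `t < a` and `t < b` say exactly that the lengths differ by less than one.
  · have ht0 : 0 < (a + b - 1) / 2 := by linarith
    have hta : (a + b - 1) / 2 < a := by linarith
    have htb : (a + b - 1) / 2 < b := by linarith
    refine (lintegral_lintegral_neg_add_le hA hAfin hBfin hg hg1 hgint
      (t := ENNReal.ofReal ((a + b - 1) / 2)) (by simpa using ht0) ?_ ?_).trans ?_
    · rw [ha']; exact (ENNReal.ofReal_lt_ofReal_iff (by linarith)).2 hta
    · rw [hb']; exact (ENNReal.ofReal_lt_ofReal_iff (by linarith)).2 htb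
    · rw [ha', hb', ← ENNReal.ofReal_sub _ ht0.le, ← ENNReal.ofReal_sub _ ht0.le]
      exact le_lintegral_lintegral_centeredInterval (by ring) ht0 hta htb

/-! ### Domination and its stability under convolution -/

/-- If `F` dominates `f` in the sense of maximal integrals over sets of given measure, then it
does so in the sense of excess integrals. -/
theorem lintegral_tsub_le_of_forall_setLIntegral_le {f F : ℝ → ℝ≥0∞} (hf : Measurable f)
    (hfint : ∫⁻ x, f x ≠ ⊤)
    (h : ∀ A, MeasurableSet A → ∫⁻ x in A, f x ≤ ∫⁻ x in centeredInterval (volume A), F x)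
    {t : ℝ≥0∞} (htop : t ≠ ⊤) : ∫⁻ x, (f x - t) ≤ ∫⁻ x, (F x - t) := by
  -- Level `0` is separate: Markov's inequality makes the superlevel set finite only for positive
  -- `t`, and finiteness is needed to cancel `t * volume A`.
  rcases eq_or_ne t 0 with rfl | ht0
  · simpa [centeredInterval_top] using h univ MeasurableSet.univ
  have hA : MeasurableSet {x | t < f x} := measurableSet_lt measurable_const hf
  set A := {x | t < f x} with hAdef
  have hAfin : volume A ≠ ⊤ := by
    refine ((measure_mono fun x (hx : t < f x) => hx.le).trans
      (meas_ge_le_lintegral_div hf.aemeasurable ht0 htop)).trans_lt ?_ |>.ne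
    exact ENNReal.div_lt_top hfint ht0
  have h1 : ∫⁻ x, (f x - t) = ∫⁻ x in A, (f x - t) := by
    rw [← lintegral_indicator hA]
    refine lintegral_congr fun x => ?_
    by_cases hx : x ∈ A
    · rw [indicator_of_mem hx]
    · rw [indicator_of_notMem hx]
      exact tsub_eq_zero_of_le (not_lt.1 hx)
  have h2 : ∫⁻ x in A, f x = (∫⁻ x in A, (f x - t)) + t * volume A := by
    rw [← setLIntegral_const, ← lintegral_add_right _ measurable_const]
    exact setLIntegral_congr_fun hA fun x (hx : t < f x) => (tsub_add_cancel_of_le hx.le).symm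
  have h3 : ∫⁻ x in centeredInterval (volume A), F x ≤
      (∫⁻ x in centeredInterval (volume A), (F x - t)) + t * volume A := by
    conv_rhs => rw [← volume_centeredInterval (volume A), ← setLIntegral_const,
      volume_centeredInterval, ← lintegral_add_right _ measurable_const]
    exact lintegral_mono fun x => le_tsub_add
  have h4 := (h2.symm.le.trans (h A hA)).trans h3
  rw [h1]
  exact ((ENNReal.add_le_add_iff_right (ENNReal.mul_ne_top htop hAfin)).1 h4).trans (setLIntegral_le_lintegral _ _)

/-- Take as level `t` the value of `F` at the endpoint of the interval. The excess of `F` over `t`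
then lives on the interval and `F = (F - t) + t` there, while `f* ≤ (f* - t) + t` always.
Equimeasurability reduces the claim to the excess integrals of `f` and `F`. -/
theorem setLIntegral_symmDecRearr_le {f F : ℝ → ℝ≥0∞} (hf : Measurable f)
    (hfint : ∫⁻ x, f x ≠ ⊤) (hF : AbsAntitone F) (hFtop : ∀ x, F x ≠ ⊤)
    (h : ∀ A, MeasurableSet A → ∫⁻ x in A, f x ≤ ∫⁻ x in centeredInterval (volume A), F x)
    (m : ℝ≥0∞) :
    ∫⁻ x in centeredInterval m, symmDecRearr f x ≤ ∫⁻ x in centeredInterval m, F x := by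
  have hFm := hF.measurable
  rcases eq_or_ne m ⊤ with rfl | hm
  · simpa [centeredInterval_top, lintegral_symmDecRearr hf] using h univ MeasurableSet.univ
  obtain ⟨r, hr0, rfl⟩ : ∃ r : ℝ, 0 ≤ r ∧ m = ENNReal.ofReal r :=
    ⟨m.toReal, ENNReal.toReal_nonneg, (ENNReal.ofReal_toReal hm).symm⟩
  set J := centeredInterval (ENNReal.ofReal r) with hJ
  have hJm : MeasurableSet J := measurableSet_centeredInterval _
  set t := F (r / 2) with ht
  have hr2 : |r / 2| = r / 2 := abs_of_nonneg (by linarith)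
  have hin : ∀ x ∈ J, t ≤ F x := fun x hx => hF _ _ (by
    rw [mem_centeredInterval_ofReal] at hx; rw [hr2]; linarith)
  have hout : ∀ x ∉ J, F x ≤ t := fun x hx => hF _ _ (by
    rw [mem_centeredInterval_ofReal] at hx; rw [hr2]; linarith)
  calc ∫⁻ x in J, symmDecRearr f x
      ≤ ∫⁻ x in J, ((symmDecRearr f x - t) + t) := lintegral_mono fun x => le_tsub_add
    _ = (∫⁻ x in J, (symmDecRearr f x - t)) + t * volume J := by
        rw [lintegral_add_right _ measurable_const, setLIntegral_const]
    _ ≤ (∫⁻ x, (F x - t)) + t * volume J := by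
        refine add_le_add ((setLIntegral_le_lintegral _ _).trans ?_) le_rfl
        rw [lintegral_symmDecRearr_tsub hf]
        exact lintegral_tsub_le_of_forall_setLIntegral_le hf hfint h (hFtop _)
    _ = (∫⁻ x in J, (F x - t)) + t * volume J := by
        congr 1
        rw [← lintegral_indicator hJm]
        refine lintegral_congr fun x => ?_
        by_cases hx : x ∈ J
        · rw [indicator_of_mem hx]
        · rw [indicator_of_notMem hx]
          exact tsub_eq_zero_of_le (hout x hx)
    _ = ∫⁻ x in J, F x := by
        rw [← setLIntegral_const, ← lintegral_add_right _ measurable_const]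
        exact setLIntegral_congr_fun hJm fun x hx => tsub_add_cancel_of_le (hin x hx)

theorem setLIntegral_lconvolution {f g : ℝ → ℝ≥0∞} (hf : Measurable f) (hg : Measurable g)
    (A : Set ℝ) :
    ∫⁻ x in A, lconvolution f g volume x = ∫⁻ y, f y * ∫⁻ x in A, g (-y + x) := by
  simp only [lconvolution_def]
  rw [lintegral_lintegral_swap (by fun_prop)]
  exact lintegral_congr fun y => lintegral_const_mul _ (by fun_prop)

theorem lintegral_lconvolution {f g : ℝ → ℝ≥0∞} (hf : Measurable f) (hg : Measurable g) :
    ∫⁻ x, lconvolution f g volume x = (∫⁻ x, f x) * ∫⁻ x, g x := by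
  have := setLIntegral_lconvolution hf hg univ
  simp only [Measure.restrict_univ, lintegral_add_left_eq_self] at this
  rw [this, lintegral_mul_const _ hf]

theorem lconvolution_le_lintegral {f g : ℝ → ℝ≥0∞} (hf : ∀ x, f x ≤ 1) (x : ℝ) :
    lconvolution f g volume x ≤ ∫⁻ y, g y := by
  rw [← lintegral_sub_left_eq_self g x, lconvolution_def]
  refine lintegral_mono fun y => ?_
  rw [neg_add_eq_sub]
  exact mul_le_of_le_one_left' (hf y)

theorem measurable_indicator_centeredInterval (m : ℝ≥0∞) :
    Measurable ((centeredInterval m).indicator (1 : ℝ → ℝ≥0∞)) :=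
  measurable_one.indicator (measurableSet_centeredInterval _)

theorem AbsAntitone.setLIntegral_centeredInterval {G : ℝ → ℝ≥0∞} (hG : AbsAntitone G) (m : ℝ≥0∞) :
    AbsAntitone fun y => ∫⁻ x in centeredInterval m, G (-y + x) := by
  have := (absAntitone_indicator_centeredInterval m).lconvolution hG
  convert this using 2 with y
  rw [lconvolution_def, ← lintegral_indicator (measurableSet_centeredInterval _)]
  refine lintegral_congr fun x => ?_
  have e : G (-y + x) = G (-x + y) := by rw [← hG.apply_neg]; congr 1; ring
  by_cases hx : x ∈ centeredInterval m <;> simp [hx, e]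

/-- Domination by `F` is preserved under convolution of `f` with a density bounded by one and of
`F` with the indicator function of the unit interval. -/
theorem setLIntegral_lconvolution_le {f F g : ℝ → ℝ≥0∞} (hf : Measurable f)
    (hfint : ∫⁻ x, f x ≠ ⊤) (hF : AbsAntitone F) (hFtop : ∀ x, F x ≠ ⊤)
    (h : ∀ A, MeasurableSet A → ∫⁻ x in A, f x ≤ ∫⁻ x in centeredInterval (volume A), F x)
    (hg : Measurable g) (hg1 : ∀ x, g x ≤ 1) (hgint : ∫⁻ x, g x = 1)
    {A : Set ℝ} (hA : MeasurableSet A) :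
    ∫⁻ x in A, lconvolution f g volume x ≤ ∫⁻ x in centeredInterval (volume A),
      lconvolution F ((centeredInterval 1).indicator 1) volume x := by
  have hm := measurable_indicator_centeredInterval 1
  have hFm := hF.measurable
  have hK : AbsAntitone fun y => ∫⁻ x in centeredInterval (volume A),
      (centeredInterval 1).indicator (1 : ℝ → ℝ≥0∞) (-y + x) :=
    (absAntitone_indicator_centeredInterval 1).setLIntegral_centeredInterval _
  have hfs := (absAntitone_symmDecRearr f).measurable
  rw [setLIntegral_lconvolution hf hg, setLIntegral_lconvolution hFm hm]
  set K := fun y => ∫⁻ x in centeredInterval (volume A),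
      (centeredInterval 1).indicator (1 : ℝ → ℝ≥0∞) (-y + x) with hKdef
  have hKm := hK.measurable
  calc ∫⁻ y, f y * ∫⁻ x in A, g (-y + x)
      = ∫⁻ s in Ioi (0 : ℝ), ∫⁻ y in {y | ENNReal.ofReal s < f y}, ∫⁻ x in A, g (-y + x) :=
        lintegral_mul_eq_lintegral_setLIntegral hf
          (Measurable.lintegral_prod_right' (f := fun p : ℝ × ℝ => g (-p.1 + p.2)) (by fun_prop))
    _ ≤ ∫⁻ s in Ioi (0 : ℝ), ∫⁻ y in {y | ENNReal.ofReal s < symmDecRearr f y}, K y := by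
        -- The Riesz inequality, applied to `A` and a superlevel set of `f`.
        refine lintegral_mono fun s => ?_
        rw [lintegral_lintegral_swap (by fun_prop),
          setLIntegral_congr (setOf_lt_symmDecRearr_ae_eq f _)]
        refine (lintegral_lintegral_neg_add_le_centeredInterval hA hg hg1 hgint).trans_eq ?_
        rw [lintegral_lintegral_swap (by fun_prop)]
    _ = ∫⁻ y, K y * symmDecRearr f y := by
        rw [← lintegral_mul_eq_lintegral_setLIntegral hfs hKm]
        exact lintegral_congr fun y => mul_comm _ _
    _ = ∫⁻ s in Ioi (0 : ℝ), ∫⁻ y in {y | ENNReal.ofReal s < K y}, symmDecRearr f y :=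
        lintegral_mul_eq_lintegral_setLIntegral hKm hfs
    _ ≤ ∫⁻ s in Ioi (0 : ℝ), ∫⁻ y in {y | ENNReal.ofReal s < K y}, F y := by
        -- Superlevel sets of `K` are centered intervals a.e., where `F` beats `f*` by domination.
        refine lintegral_mono fun s => ?_
        rw [setLIntegral_congr (hK.ae_eq_centeredInterval _),
          setLIntegral_congr (hK.ae_eq_centeredInterval _)]
        exact setLIntegral_symmDecRearr_le hf hfint hF hFtop h _
    _ = ∫⁻ y, F y * K y := by
        rw [← lintegral_mul_eq_lintegral_setLIntegral hKm hFm]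
        exact lintegral_congr fun y => mul_comm _ _

theorem lintegral_mul_le_of_forall_setLIntegral_le {f F : ℝ → ℝ≥0∞} (hf : Measurable f)
    (hF : Measurable F)
    (h : ∀ A, MeasurableSet A → ∫⁻ x in A, f x ≤ ∫⁻ x in centeredInterval (volume A), F x)
    {k : ℝ → ℝ≥0∞} (hk : AEMeasurable k volume) :
    ∫⁻ x, k x * f x ≤ ∫⁻ x, symmDecRearr k x * F x := by
  rw [symmDecRearr_congr_ae hk.ae_eq_mk,
    lintegral_congr_ae (g := fun x => hk.mk k x * f x) (by
      filter_upwards [hk.ae_eq_mk] with x hx; rw [hx])]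
  generalize hk.mk k = k', hk.measurable_mk = hk'
  rw [lintegral_mul_eq_lintegral_setLIntegral hk' hf,
    lintegral_mul_eq_lintegral_setLIntegral (absAntitone_symmDecRearr k').measurable hF]
  refine lintegral_mono fun s => ?_
  rw [setLIntegral_congr (setOf_lt_symmDecRearr_ae_eq k' _)]
  exact h _ (measurableSet_lt measurable_const hk')

/-! ### Splines, multiple convolutions and the inequality -/

theorem cardinalBSpline_one_eq : cardinalBSpline 1 = (centeredInterval 1).indicator 1 := by
  rw [centeredInterval_one, cardinalBSpline]

theorem cardinalBSpline_succ_succ (n : ℕ) : cardinalBSpline (n + 2) =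
    lconvolution (cardinalBSpline (n + 1)) (cardinalBSpline 1) volume := by
  rw [cardinalBSpline]
  simp only [cardinalBSpline]

theorem multiConv_succ_succ (n : ℕ) (g : Fin (n + 2) → ℝ → ℝ≥0∞) : multiConv (n + 2) g =
    lconvolution (multiConv (n + 1) fun i => g i.castSucc) (g (Fin.last (n + 1))) volume := rfl

/-- Lets the mass, integrability and variance results for `multiConv` apply to the splines as well.
-/
theorem multiConv_cardinalBSpline_one (n : ℕ) :
    multiConv (n + 1) (fun _ => cardinalBSpline 1) = cardinalBSpline (n + 1) := by
  induction n with
  | zero => rfl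
  | succ n ih => rw [multiConv_succ_succ, cardinalBSpline_succ_succ, ih]

theorem absAntitone_cardinalBSpline (n : ℕ) : AbsAntitone (cardinalBSpline (n + 1)) := by
  have h1 : AbsAntitone (cardinalBSpline 1) := by
    rw [cardinalBSpline_one_eq]; exact absAntitone_indicator_centeredInterval 1
  induction n with
  | zero => exact h1
  | succ n ih =>
    rw [cardinalBSpline_succ_succ]
    exact ih.lconvolution h1

theorem lintegral_cardinalBSpline_one : ∫⁻ x, cardinalBSpline 1 x = 1 := by
  rw [cardinalBSpline_one_eq, lintegral_indicator_one (measurableSet_centeredInterval _),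
    volume_centeredInterval]

theorem cardinalBSpline_le_one (n : ℕ) (x : ℝ) : cardinalBSpline (n + 1) x ≤ 1 := by
  induction n generalizing x with
  | zero =>
    rw [cardinalBSpline_one_eq]
    exact indicator_le_self' (by simp) x
  | succ n ih =>
    rw [cardinalBSpline_succ_succ, ← lintegral_cardinalBSpline_one]
    exact lconvolution_le_lintegral ih x

theorem measurable_multiConv {n : ℕ} {g : Fin (n + 1) → ℝ → ℝ≥0∞} (hg : ∀ j, Measurable (g j)) :
    Measurable (multiConv (n + 1) g) := by
  induction n with
  | zero => exact hg 0
  | succ n ih => exact measurable_lconvolution _ (ih fun j => hg _) (hg _)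

theorem lintegral_multiConv {n : ℕ} {g : Fin (n + 1) → ℝ → ℝ≥0∞} (hg : ∀ j, Measurable (g j))
    (hgint : ∀ j, ∫⁻ x, g j x = 1) : ∫⁻ x, multiConv (n + 1) g x = 1 := by
  induction n with
  | zero => exact hgint 0
  | succ n ih =>
    rw [multiConv_succ_succ, lintegral_lconvolution (measurable_multiConv fun j => hg _) (hg _),
      ih (fun j => hg _) fun j => hgint _, hgint, one_mul]

theorem setLIntegral_multiConv_le {n : ℕ} {g : Fin (n + 1) → ℝ → ℝ≥0∞}
    (hg : ∀ j, Measurable (g j)) (hg1 : ∀ j x, g j x ≤ 1) (hgint : ∀ j, ∫⁻ x, g j x = 1)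
    {A : Set ℝ} (hA : MeasurableSet A) :
    ∫⁻ x in A, multiConv (n + 1) g x ≤
      ∫⁻ x in centeredInterval (volume A), cardinalBSpline (n + 1) x := by
  induction n generalizing A with
  | zero =>
    change ∫⁻ x in A, g 0 x ≤ ∫⁻ x in centeredInterval (volume A), cardinalBSpline 1 x
    rw [cardinalBSpline_one_eq,
      setLIntegral_indicator (measurableSet_centeredInterval _), inter_comm,
      centeredInterval_inter]
    -- The base case is `∫_A g ≤ min |A| 1`, from `g ≤ 1` and total mass one.
    simp only [Pi.one_apply, setLIntegral_one, volume_centeredInterval]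
    refine le_min ?_ ((setLIntegral_le_lintegral _ _).trans_eq (hgint 0))
    rw [← setLIntegral_one A]
    exact lintegral_mono (hg1 0)
  | succ n ih =>
    rw [multiConv_succ_succ, cardinalBSpline_succ_succ, cardinalBSpline_one_eq]
    refine setLIntegral_lconvolution_le (measurable_multiConv fun j => hg _) ?_
      (absAntitone_cardinalBSpline n)
      (fun x => ((cardinalBSpline_le_one n x).trans_lt ENNReal.one_lt_top).ne)
      (fun B hB => ih (fun j => hg _) (fun j => hg1 _) (fun j => hgint _) hB)
      (hg _) (hg1 _) (hgint _) hA
    rw [lintegral_multiConv (fun j => hg _) fun j => hgint _]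
    exact ENNReal.one_ne_top

theorem lintegral_mul_multiConv_le {n : ℕ} {g : Fin (n + 1) → ℝ → ℝ≥0∞}
    (hg : ∀ j, Measurable (g j)) (hg1 : ∀ j x, g j x ≤ 1) (hgint : ∀ j, ∫⁻ x, g j x = 1)
    {h : ℝ → ℝ≥0∞} (hh : AEMeasurable h volume) :
    ∫⁻ x, h x * multiConv (n + 1) g x ≤ ∫⁻ x, symmDecRearr h x * cardinalBSpline (n + 1) x :=
  lintegral_mul_le_of_forall_setLIntegral_le (measurable_multiConv hg)
    (absAntitone_cardinalBSpline n).measurable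
    (fun _ hA => setLIntegral_multiConv_le hg hg1 hgint hA) hh

theorem lconvolution_congr_ae {f f' g g' : ℝ → ℝ≥0∞} (hf : f =ᵐ[volume] f')
    (hg : g =ᵐ[volume] g') : lconvolution f g volume = lconvolution f' g' volume := by
  ext x
  refine lintegral_congr_ae ?_
  have h := (Measure.measurePreserving_sub_left volume x).quasiMeasurePreserving.ae hg
  filter_upwards [hf, h] with y h1 h2
  rw [neg_add_eq_sub, h1, h2]

theorem multiConv_congr_ae {n : ℕ} {g g' : Fin n → ℝ → ℝ≥0∞} (h : ∀ j, g j =ᵐ[volume] g' j) :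
    multiConv n g =ᵐ[volume] multiConv n g' := by
  induction n with
  | zero => rfl
  | succ n ih =>
    cases n with
    | zero => exact h 0
    | succ n =>
      rw [multiConv_succ_succ, multiConv_succ_succ, lconvolution_congr_ae (ih fun j => h _) (h _)]

/-! ### Equality case: second moments and variances -/

theorem AbsAntitone.lintegral_symmDecRearr_mul {h F : ℝ → ℝ≥0∞} (hh : AbsAntitone h)
    (hF : Measurable F) : ∫⁻ x, symmDecRearr h x * F x = ∫⁻ x, h x * F x := by
  rw [lintegral_mul_eq_lintegral_setLIntegral (absAntitone_symmDecRearr h).measurable hF,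
    lintegral_mul_eq_lintegral_setLIntegral hh.measurable hF]
  refine lintegral_congr fun s => ?_
  rw [setLIntegral_congr (setOf_lt_symmDecRearr_ae_eq h _),
    setLIntegral_congr (hh.ae_eq_centeredInterval _)]

/-- The weight `x ^ 2` increases in `|x|` and is not itself a test function. The complements of its
superlevel sets are, and equal total masses carry the equality over to the superlevel sets. -/
theorem lintegral_sq_mul_eq_of_forall_absAntitone {f F : ℝ → ℝ≥0∞} (hf : Measurable f)
    (hF : Measurable F) (hfint : ∫⁻ x, f x = 1) (hFint : ∫⁻ x, F x = 1)
    (h : ∀ k, AbsAntitone k → ∫⁻ x, k x * f x = ∫⁻ x, k x * F x) :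
    ∫⁻ x, ENNReal.ofReal (x ^ 2) * f x = ∫⁻ x, ENNReal.ofReal (x ^ 2) * F x := by
  have hsq : Measurable fun x : ℝ => ENNReal.ofReal (x ^ 2) := by fun_prop
  rw [lintegral_mul_eq_lintegral_setLIntegral hsq hf,
    lintegral_mul_eq_lintegral_setLIntegral hsq hF]
  refine lintegral_congr fun s => ?_
  have hA : MeasurableSet {x : ℝ | ENNReal.ofReal s < ENNReal.ofReal (x ^ 2)} :=
    measurableSet_lt measurable_const hsq
  set A := {x : ℝ | ENNReal.ofReal s < ENNReal.ofReal (x ^ 2)} with hAdef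
  have hk : AbsAntitone (Aᶜ.indicator 1) := by
    classical
    intro x y hxy
    simp only [indicator_apply, Pi.one_apply]
    split_ifs with hy hx
    · exact le_rfl
    · refine absurd (fun hx' => hy ?_) hx
      exact lt_of_lt_of_le hx' (ENNReal.ofReal_le_ofReal (sq_le_sq.2 hxy))
    · exact zero_le_one
    · exact le_rfl
  have hind : ∀ k : ℝ → ℝ≥0∞, ∫⁻ x, Aᶜ.indicator (1 : ℝ → ℝ≥0∞) x * k x = ∫⁻ x in Aᶜ, k x := by
    intro k
    rw [← lintegral_indicator hA.compl]
    refine lintegral_congr fun x => ?_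
    by_cases hx : x ∈ Aᶜ
    · rw [indicator_of_mem hx, indicator_of_mem hx, Pi.one_apply, one_mul]
    · rw [indicator_of_notMem hx, indicator_of_notMem hx, zero_mul]
  have h1 := h _ hk
  rw [hind, hind] at h1
  have h2 := (lintegral_add_compl f hA).trans (hfint.trans (hFint.symm.trans
    (lintegral_add_compl F hA).symm))
  rw [h1] at h2
  refine (ENNReal.add_left_inj ?_).1 h2
  exact ((setLIntegral_le_lintegral _ _).trans_lt (hFint.trans_lt ENNReal.one_lt_top)).ne

theorem isProbabilityMeasure_withDensity_volume {g : ℝ → ℝ≥0∞} (hg : ∫⁻ x, g x = 1) :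
    IsProbabilityMeasure (volume.withDensity g) :=
  ⟨by rw [withDensity_apply _ MeasurableSet.univ, Measure.restrict_univ, hg]⟩

open ProbabilityTheory

/-- By Fubini, `x + y` is square integrable in `x` for some fixed `y`; subtracting the constant `y`
keeps this. -/
theorem memLp_id_two_of_conv {μ ν : Measure ℝ} [IsProbabilityMeasure μ] [IsProbabilityMeasure ν]
    (h : MemLp id 2 (μ ∗ ν)) : MemLp id 2 μ := by
  have h1 : Integrable (fun p : ℝ × ℝ => (p.1 + p.2) ^ 2) (μ.prod ν) := by
    have := h.integrable_sq
    rw [Measure.conv, integrable_map_measure (by fun_prop) (by fun_prop)] at this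
    exact this
  obtain ⟨y, hy⟩ := h1.prod_left_ae.exists
  have h2 : MemLp (fun x => x + y) 2 μ := (memLp_two_iff_integrable_sq (by fun_prop)).2 hy
  have h3 := h2.sub (memLp_const y)
  refine h3.congr_norm (by fun_prop) (Filter.Eventually.of_forall fun x => ?_)
  simp

theorem memLp_id_two_conv {μ ν : Measure ℝ} [IsProbabilityMeasure μ] [IsProbabilityMeasure ν]
    (hμ : MemLp id 2 μ) (hν : MemLp id 2 ν) : MemLp id 2 (μ ∗ ν) := by
  rw [Measure.conv, memLp_map_measure_iff (by fun_prop) (by fun_prop)]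
  exact (hμ.comp_fst ν).add (hν.comp_snd μ)

theorem variance_id_conv {μ ν : Measure ℝ} [IsProbabilityMeasure μ] [IsProbabilityMeasure ν]
    (hμ : MemLp id 2 μ) (hν : MemLp id 2 ν) :
    Var[id; μ ∗ ν] = Var[id; μ] + Var[id; ν] := by
  rw [Measure.conv, variance_id_map (by fun_prop)]
  change Var[fun p : ℝ × ℝ => id p.1 + id p.2; μ.prod ν] = _
  exact variance_add_prod hμ hν

theorem withDensity_multiConv_succ_succ {n : ℕ} {g : Fin (n + 2) → ℝ → ℝ≥0∞}
    (hg : ∀ j, Measurable (g j)) :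
    volume.withDensity (multiConv (n + 2) g) =
      volume.withDensity (multiConv (n + 1) fun i => g i.castSucc) ∗
        volume.withDensity (g (Fin.last (n + 1))) := by
  rw [conv_withDensity_eq_lconvolution (measurable_multiConv fun j => hg _) (hg _),
    multiConv_succ_succ]

theorem memLp_id_two_multiConv_iff {n : ℕ} {g : Fin (n + 1) → ℝ → ℝ≥0∞}
    (hg : ∀ j, Measurable (g j)) (hgint : ∀ j, ∫⁻ x, g j x = 1) :
    MemLp id 2 (volume.withDensity (multiConv (n + 1) g)) ↔
      ∀ j, MemLp id 2 (volume.withDensity (g j)) := by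
  induction n with
  | zero => exact ⟨fun h j => by rw [Fin.fin_one_eq_zero j]; exact h, fun h => h 0⟩
  | succ n ih =>
    have := isProbabilityMeasure_withDensity_volume
      (lintegral_multiConv (g := fun i => g i.castSucc) (fun j => hg _) fun j => hgint _)
    have := isProbabilityMeasure_withDensity_volume (hgint (Fin.last (n + 1)))
    rw [withDensity_multiConv_succ_succ hg, Fin.forall_fin_succ',
      ← ih (fun j => hg _) fun j => hgint _]
    refine ⟨fun h => ⟨memLp_id_two_of_conv h, ?_⟩, fun h => memLp_id_two_conv h.1 h.2⟩
    rw [Measure.conv_comm] at h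
    exact memLp_id_two_of_conv h

theorem variance_id_multiConv {n : ℕ} {g : Fin (n + 1) → ℝ → ℝ≥0∞}
    (hg : ∀ j, Measurable (g j)) (hgint : ∀ j, ∫⁻ x, g j x = 1)
    (h : ∀ j, MemLp id 2 (volume.withDensity (g j))) :
    Var[id; volume.withDensity (multiConv (n + 1) g)] =
      ∑ j, Var[id; volume.withDensity (g j)] := by
  induction n with
  | zero => rw [Fin.sum_univ_one]; rfl
  | succ n ih =>
    have := isProbabilityMeasure_withDensity_volume
      (lintegral_multiConv (g := fun i => g i.castSucc) (fun j => hg _) fun j => hgint _)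
    have := isProbabilityMeasure_withDensity_volume (hgint (Fin.last (n + 1)))
    rw [Fin.sum_univ_castSucc, withDensity_multiConv_succ_succ hg, variance_id_conv
      ((memLp_id_two_multiConv_iff (fun j => hg _) fun j => hgint _).2 fun j => h _) (h _),
      ih (fun j => hg _) (fun j => hgint _) (fun j => h _)]

theorem withDensity_cardinalBSpline_one :
    volume.withDensity (cardinalBSpline 1) = volume.restrict (Ioo (-1 / 2 : ℝ) (1 / 2)) := by
  rw [cardinalBSpline, withDensity_indicator_one measurableSet_Ioo]

theorem setIntegral_Ioo_sq_sub (c : ℝ) :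
    ∫ x in Ioo (c - 1 / 2) (c + 1 / 2), (x - c) ^ 2 = 1 / 12 := by
  rw [← integral_Ioc_eq_integral_Ioo, ← intervalIntegral.integral_of_le (by linarith),
    intervalIntegral.integral_comp_sub_right (fun x => x ^ 2), integral_pow]
  ring

theorem memLp_id_two_cardinalBSpline_one :
    MemLp id 2 (volume.withDensity (cardinalBSpline 1)) := by
  rw [withDensity_cardinalBSpline_one]
  refine MemLp.of_bound (by fun_prop) 1 ?_
  refine (ae_restrict_iff' measurableSet_Ioo).2 (Filter.Eventually.of_forall fun x hx => ?_)
  rw [id, Real.norm_eq_abs, abs_le]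
  constructor <;> linarith [hx.1, hx.2]

theorem variance_id_cardinalBSpline_one_le :
    Var[id; volume.withDensity (cardinalBSpline 1)] ≤ 1 / 12 := by
  have := isProbabilityMeasure_withDensity_volume lintegral_cardinalBSpline_one
  refine (variance_le_expectation_sq (by fun_prop)).trans ?_
  rw [withDensity_cardinalBSpline_one]
  have := setIntegral_Ioo_sq_sub 0
  simp only [zero_sub, zero_add, sub_zero] at this
  rw [neg_div]
  exact this.le

theorem AbsAntitone.integral_withDensity_id {F : ℝ → ℝ≥0∞} (hF : AbsAntitone F)
    (hFtop : ∀ x, F x ≠ ⊤) : ∫ x, x ∂(volume.withDensity F) = 0 := by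
  rw [integral_withDensity_eq_integral_toReal_smul hF.measurable
    (Filter.Eventually.of_forall fun x => (hFtop x).lt_top)]
  have h := integral_neg_eq_self (fun x => (F x).toReal • x) volume
  simp only [hF.apply_neg, smul_neg, integral_neg] at h
  linarith

/-! ### Minimal variance and the extremal densities -/

/-- Bathtub principle: with `c` the mean and `I` the unit interval about `c`, the product `(g - 1_I)
* ((x - c)² - 1/4)` is nonnegative because both factors change sign together. As `g` and `1_I` have
equal mass, its integral is the variance minus `1/12`; if that vanishes, so does the product a.e. -/
theorem one_div_twelve_le_variance {g : ℝ → ℝ≥0∞} (hg : Measurable g) (hg1 : ∀ x, g x ≤ 1)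
    (hgint : ∫⁻ x, g x = 1) (h : MemLp id 2 (volume.withDensity g)) :
    1 / 12 ≤ Var[id; volume.withDensity g] ∧ (Var[id; volume.withDensity g] = 1 / 12 →
      ∃ c : ℝ, g =ᵐ[volume] (Ioo (c - 1 / 2) (c + 1 / 2)).indicator 1) := by
  have hprob := isProbabilityMeasure_withDensity_volume hgint
  set c := ∫ x, id x ∂(volume.withDensity g) with hc
  set I := Ioo (c - 1 / 2) (c + 1 / 2) with hI
  have hlt : ∀ᵐ x ∂volume, g x < ⊤ :=
    Filter.Eventually.of_forall fun x => (hg1 x).trans_lt ENNReal.one_lt_top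
  have hvar : Var[id; volume.withDensity g] = ∫ x, (g x).toReal * (x - c) ^ 2 := by
    rw [variance_eq_integral (by fun_prop),
      integral_withDensity_eq_integral_toReal_smul hg hlt]
    rfl
  have hint1 : Integrable fun x => (g x).toReal * (x - c) ^ 2 := by
    have h1 : Integrable (fun x => (x - c) ^ 2) (volume.withDensity g) :=
      (h.sub (memLp_const c)).integrable_sq
    exact (integrable_withDensity_iff_integrable_smul' hg hlt).1 h1
  have hint2 : Integrable fun x => (g x).toReal :=
    integrable_toReal_of_lintegral_ne_top hg.aemeasurable (by simp [hgint])
  have hgi : ∫ x, (g x).toReal = 1 := by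
    rw [integral_toReal hg.aemeasurable hlt, hgint, ENNReal.toReal_one]
  have hint3 : IntegrableOn (fun x => (x - c) ^ 2) I :=
    (Continuous.integrableOn_Icc (by fun_prop)).mono_set Ioo_subset_Icc_self
  have hint4 : IntegrableOn (fun _ => (1 : ℝ) / 4) I := by simp [hI]
  set φ : ℝ → ℝ := fun x => (g x).toReal * (x - c) ^ 2 - (g x).toReal * (1 / 4) -
    (I.indicator (fun x => (x - c) ^ 2) x - I.indicator (fun _ => 1 / 4) x) with hφ
  have hφint : ∫ x, φ x = Var[id; volume.withDensity g] - 1 / 12 := by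
    have e1 : ∫ x, φ x = (∫ x, ((g x).toReal * (x - c) ^ 2 - (g x).toReal * (1 / 4))) -
        ∫ x, (I.indicator (fun x => (x - c) ^ 2) x - I.indicator (fun _ => 1 / 4) x) :=
      integral_sub (hint1.sub (hint2.mul_const _))
        ((hint3.integrable_indicator measurableSet_Ioo).sub
          (hint4.integrable_indicator measurableSet_Ioo))
    rw [e1, integral_sub hint1 (hint2.mul_const _),
      integral_sub (hint3.integrable_indicator measurableSet_Ioo)
        (hint4.integrable_indicator measurableSet_Ioo),
      integral_indicator measurableSet_Ioo, integral_indicator measurableSet_Ioo,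
      setIntegral_Ioo_sq_sub, integral_mul_const, hgi, ← hvar, setIntegral_const]
    simp
    ring
  have hφi : Integrable φ := (hint1.sub (hint2.mul_const _)).sub
      ((hint3.integrable_indicator measurableSet_Ioo).sub
        (hint4.integrable_indicator measurableSet_Ioo))
  have hle1 : ∀ x, (g x).toReal ≤ 1 := fun x => by
    simpa using ENNReal.toReal_mono ENNReal.one_ne_top (hg1 x)
  have hin : ∀ x ∈ I, φ x = (1 / 4 - (x - c) ^ 2) * (1 - (g x).toReal) ∧ 0 < 1 / 4 - (x - c) ^ 2 := by
    intro x hx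
    simp only [hφ, indicator_of_mem hx]
    refine ⟨by ring, ?_⟩
    nlinarith [hx.1, hx.2]
  have hout : ∀ x ∉ I, φ x = ((x - c) ^ 2 - 1 / 4) * (g x).toReal ∧ 0 ≤ (x - c) ^ 2 - 1 / 4 := by
    intro x hx
    simp only [hφ, indicator_of_notMem hx]
    refine ⟨by ring, ?_⟩
    rw [hI, mem_Ioo, not_and_or, not_lt, not_lt] at hx
    rcases hx with hx | hx <;> nlinarith
  have hφ0 : 0 ≤ φ := by
    intro x
    by_cases hx : x ∈ I
    · rw [(hin x hx).1]
      exact mul_nonneg (hin x hx).2.le (by linarith [hle1 x])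
    · rw [(hout x hx).1]
      exact mul_nonneg (hout x hx).2 ENNReal.toReal_nonneg
  have hφ0' := integral_nonneg (μ := volume) hφ0
  refine ⟨by linarith, fun heq => ⟨c, ?_⟩⟩
  have hz := (integral_eq_zero_iff_of_nonneg hφ0 hφi).1 (by rw [hφint, heq, sub_self])
  -- At the endpoints of `I` the second factor vanishes and gives no information on `g`.
  have hne : ∀ᵐ x : ℝ, x ≠ c - 1 / 2 ∧ x ≠ c + 1 / 2 :=
    (Measure.ae_ne volume _).and (Measure.ae_ne volume _)
  filter_upwards [hz, hne] with x hx0 hxne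
  have hgx : g x ≠ ⊤ := ((hg1 x).trans_lt ENNReal.one_lt_top).ne
  by_cases hx : x ∈ I
  · rw [indicator_of_mem hx, Pi.one_apply, ← ENNReal.ofReal_toReal hgx]
    rw [(hin x hx).1] at hx0
    have := (mul_eq_zero.1 hx0).resolve_left (hin x hx).2.ne'
    rw [← sub_eq_zero.1 this, ENNReal.ofReal_one]
  · rw [indicator_of_notMem hx, ← ENNReal.ofReal_toReal hgx]
    rw [(hout x hx).1] at hx0
    rcases mul_eq_zero.1 hx0 with h0 | h0
    · exfalso
      have : (x - (c - 1 / 2)) * (x - (c + 1 / 2)) = 0 := by linarith [h0]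
      rcases mul_eq_zero.1 this with h' | h'
      exacts [hxne.1 (sub_eq_zero.1 h'), hxne.2 (sub_eq_zero.1 h')]
    · rw [h0, ENNReal.ofReal_zero]

theorem symmDecRearr_indicator_unit_interval (c : ℝ) :
    symmDecRearr ((Ioo (c - 1 / 2) (c + 1 / 2)).indicator 1) = cardinalBSpline 1 := by
  set I := Ioo (c - 1 / 2) (c + 1 / 2) with hI
  have hvol : ∀ t : ℝ≥0∞, volume {y | t < I.indicator (1 : ℝ → ℝ≥0∞) y} = if t < 1 then 1 else 0 := by
    intro t
    split_ifs with ht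
    · have : {y | t < I.indicator (1 : ℝ → ℝ≥0∞) y} = I := by
        ext y
        by_cases hy : y ∈ I <;> simp [hy, ht]
      rw [this, hI, Real.volume_Ioo, ← ENNReal.ofReal_one]
      congr 1
      ring
    · have : {y | t < I.indicator (1 : ℝ → ℝ≥0∞) y} = ∅ := by
        ext y
        by_cases hy : y ∈ I <;> simp [hy, not_lt.1 ht]
      rw [this, measure_empty]
  ext x
  simp only [symmDecRearr, hvol]
  rw [cardinalBSpline_one_eq]
  by_cases hx : x ∈ centeredInterval 1
  · rw [indicator_of_mem hx, Pi.one_apply]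
    have : {t : ℝ≥0∞ | ENNReal.ofReal (2 * |x|) < if t < 1 then 1 else 0} = Iio 1 := by
      ext t
      by_cases ht : t < 1 <;> simp only [mem_ofPred_eq, mem_Iio, ht, if_true, if_false, iff_true,
        iff_false, not_lt, zero_le]
      exact hx
    rw [this]
    refine le_antisymm (sSup_le fun t ht => le_of_lt ht) (le_of_forall_lt fun t ht => ?_)
    obtain ⟨u, htu, hu⟩ := exists_between ht
    exact htu.trans_le (le_sSup hu)
  · rw [indicator_of_notMem hx]
    have : {t : ℝ≥0∞ | ENNReal.ofReal (2 * |x|) < if t < 1 then 1 else 0} = ∅ := by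
      ext t
      by_cases ht : t < 1 <;> simp only [mem_ofPred_eq, mem_empty_iff_false, ht, if_true, if_false,
        iff_false, not_lt, zero_le]
      exact not_lt.1 hx
    rw [this, sSup_empty, bot_eq_zero]

theorem integral_sq_withDensity {f : ℝ → ℝ≥0∞} (hf : Measurable f) :
    ∫ x, x ^ 2 ∂(volume.withDensity f) = (∫⁻ x, ENNReal.ofReal (x ^ 2) * f x).toReal := by
  rw [integral_eq_lintegral_of_nonneg_ae (Filter.Eventually.of_forall fun x => sq_nonneg x)
    (by fun_prop), lintegral_withDensity_eq_lintegral_mul _ hf (by fun_prop)]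
  simp only [Pi.mul_apply, mul_comm]

theorem memLp_id_two_withDensity_iff {f : ℝ → ℝ≥0∞} (hf : Measurable f) :
    MemLp id 2 (volume.withDensity f) ↔ ∫⁻ x, ENNReal.ofReal (x ^ 2) * f x < ⊤ := by
  rw [memLp_two_iff_integrable_sq (by fun_prop), Integrable, hasFiniteIntegral_iff_ofReal
    (Filter.Eventually.of_forall fun x => sq_nonneg _),
    lintegral_withDensity_eq_lintegral_mul _ hf (by fun_prop)]
  simp only [Pi.mul_apply, mul_comm, id]
  exact and_iff_right (by fun_prop)

/-- The variances of the `gᵢ` sum to at most `(n + 1) / 12`, while each is at least `1 / 12`; hence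
all are equal to it. -/
theorem symmDecRearr_eq_of_forall_lintegral_eq {n : ℕ} {g : Fin (n + 1) → ℝ → ℝ≥0∞}
    (hg : ∀ j, Measurable (g j)) (hg1 : ∀ j x, g j x ≤ 1) (hgint : ∀ j, ∫⁻ x, g j x = 1)
    (h : ∀ k : ℝ → ℝ≥0∞, SymmDecreasing k →
      ∫⁻ x, k x * multiConv (n + 1) g x = ∫⁻ x, symmDecRearr k x * cardinalBSpline (n + 1) x)
    (j : Fin (n + 1)) : symmDecRearr (g j) = cardinalBSpline 1 := by
  have hfm := measurable_multiConv hg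
  have hF := absAntitone_cardinalBSpline n
  have hFm := hF.measurable
  have hM1 : Measurable (cardinalBSpline 1) := (absAntitone_cardinalBSpline 0).measurable
  have hFtop : ∀ x, cardinalBSpline (n + 1) x ≠ ⊤ := fun x =>
    ((cardinalBSpline_le_one n x).trans_lt ENNReal.one_lt_top).ne
  have hfint := lintegral_multiConv hg hgint
  have hFint : ∫⁻ x, cardinalBSpline (n + 1) x = 1 := by
    rw [← multiConv_cardinalBSpline_one]
    exact lintegral_multiConv (fun _ => hM1) fun _ => lintegral_cardinalBSpline_one
  have hpf := isProbabilityMeasure_withDensity_volume hfint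
  have hpF := isProbabilityMeasure_withDensity_volume hFint
  have hsq := lintegral_sq_mul_eq_of_forall_absAntitone hfm hFm hfint hFint fun k hk => by
    rw [h k hk.symmDecreasing, hk.lintegral_symmDecRearr_mul hFm]
  have hFL : MemLp id 2 (volume.withDensity (cardinalBSpline (n + 1))) := by
    rw [← multiConv_cardinalBSpline_one]
    exact (memLp_id_two_multiConv_iff (fun _ => hM1) fun _ => lintegral_cardinalBSpline_one).2
      fun _ => memLp_id_two_cardinalBSpline_one
  have hfL : MemLp id 2 (volume.withDensity (multiConv (n + 1) g)) := by
    rw [memLp_id_two_withDensity_iff hfm, hsq]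
    exact (memLp_id_two_withDensity_iff hFm).1 hFL
  have hgL := (memLp_id_two_multiConv_iff hg hgint).1 hfL
  have hsum : ∑ i, Var[id; volume.withDensity (g i)] ≤ ∑ _i : Fin (n + 1), (1 / 12 : ℝ) := by
    rw [← variance_id_multiConv hg hgint hgL]
    -- The mean of the convolution is unknown, so variance is only bounded by the second moment; the
    -- spline is centered, so there the two agree.
    calc Var[id; volume.withDensity (multiConv (n + 1) g)]
        ≤ ∫ x, x ^ 2 ∂(volume.withDensity (multiConv (n + 1) g)) :=
          variance_le_expectation_sq (by fun_prop)
      _ = ∫ x, x ^ 2 ∂(volume.withDensity (cardinalBSpline (n + 1))) := by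
          rw [integral_sq_withDensity hfm, integral_sq_withDensity hFm, hsq]
      _ = Var[id; volume.withDensity (cardinalBSpline (n + 1))] := by
          rw [variance_of_integral_eq_zero (X := id) (by fun_prop) (hF.integral_withDensity_id hFtop)]
          rfl
      _ = ∑ _i : Fin (n + 1), Var[id; volume.withDensity (cardinalBSpline 1)] := by
          rw [← multiConv_cardinalBSpline_one]
          exact variance_id_multiConv (fun _ => hM1) (fun _ => lintegral_cardinalBSpline_one)
            fun _ => memLp_id_two_cardinalBSpline_one
      _ ≤ _ := Finset.sum_le_sum fun _ _ => variance_id_cardinalBSpline_one_le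
  have hlow := fun i => one_div_twelve_le_variance (hg i) (hg1 i) (hgint i) (hgL i)
  have heq := (Finset.sum_eq_sum_iff_of_le fun i _ => (hlow i).1).1
    (le_antisymm (Finset.sum_le_sum fun i _ => (hlow i).1) hsum) j (Finset.mem_univ j)
  obtain ⟨c, hc⟩ := (hlow j).2 heq.symm
  rw [symmDecRearr_congr_ae hc, symmDecRearr_indicator_unit_interval]

theorem theorem3 (n : ℕ) (hn : 1 ≤ n) (g : Fin n → ℝ → ℝ≥0∞)
    (hg_meas : ∀ j, AEMeasurable (g j) volume)
    (hg_le : ∀ j x, g j x ≤ 1)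
    (hg_int : ∀ j, ∫⁻ x, g j x = 1) :
    (∀ h : ℝ → ℝ≥0∞, AEMeasurable h volume →
      ∫⁻ x, h x * multiConv n g x ≤ ∫⁻ x, symmDecRearr h x * cardinalBSpline n x) ∧
    ((∀ h : ℝ → ℝ≥0∞, SymmDecreasing h →
      ∫⁻ x, h x * multiConv n g x = ∫⁻ x, symmDecRearr h x * cardinalBSpline n x) →
      ∀ j, symmDecRearr (g j) =ᵐ[volume] cardinalBSpline 1) := by
  obtain ⟨n, rfl⟩ : ∃ m, n = m + 1 := ⟨n - 1, by omega⟩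
  -- Measurable representatives obey the bound by one only a.e.; truncating restores it everywhere.
  set g' : Fin (n + 1) → ℝ → ℝ≥0∞ := fun j x => min ((hg_meas j).mk _ x) 1 with hg'
  have hgg' : ∀ j, g j =ᵐ[volume] g' j := fun j => by
    filter_upwards [(hg_meas j).ae_eq_mk] with x hx
    simp only [hg']
    rw [← hx, min_eq_left (hg_le j x)]
  have hm : ∀ j, Measurable (g' j) := fun j => (hg_meas j).measurable_mk.min measurable_const
  have h1 : ∀ j x, g' j x ≤ 1 := fun j x => min_le_right _ _
  have hint : ∀ j, ∫⁻ x, g' j x = 1 := fun j => by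
    rw [← lintegral_congr_ae (hgg' j), hg_int]
  have hcongr : ∀ h : ℝ → ℝ≥0∞,
      ∫⁻ x, h x * multiConv (n + 1) g x = ∫⁻ x, h x * multiConv (n + 1) g' x := fun h =>
    lintegral_congr_ae (by filter_upwards [multiConv_congr_ae hgg'] with x hx; rw [hx])
  simp only [hcongr]
  refine ⟨fun h hh => lintegral_mul_multiConv_le hm h1 hint hh, fun h j => ?_⟩
  rw [symmDecRearr_congr_ae (hgg' j), symmDecRearr_eq_of_forall_lintegral_eq hm h1 hint h j]
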